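/- Let $n \ge 1$, and let $G = (\mathbb{Z}^n, E)$ be a PL graph: a simple undirected graph for which there are pairwise distinct integer vectors $v_1, \dots, v_k \in \mathbb{Z}^n$, with $v_i \ne -v_j$ for all $i, j$, such that for every $u \in \mathbb{Z}^n$ the neighbours of $u$ are precisely $u \pm v_1, \dots, u \pm v_k$; such that the entries of each $v_i$ have greatest common divisor $1$; and such that $v_1, \dots, v_k$ span $\mathbb{R}^n$. For $S \subseteq \mathbb{Z}^n$ let $\partial_e(S)$ be the set of (undirected) edges of $G$ with exactly one endpoint in $S$. Let $\ell_i$ be the line segment from the origin to $v_i$, let $$Z = \sum_{i=1}^k (-\ell_i + \ell_i)$$ (Minkowski sums), let $\mu_n$ be Lebesgue measure on $\mathbb{R}^n$, and for $A \subseteq \mathbb{R}^n$ let $$b(A) = \lim_{\epsilon \to 0^+} \frac{\mu_n(A + \epsilon Z) - \mu_n(A)}{\epsilon}$$ whenever this limit exists in $\mathbb{R}$. Then for every bounded convex set $X \subset \mathbb{R}^n$ with nonempty interior, the limit defining $b(\alpha X)$ exists for every real $\alpha > 0$, and, as $\alpha \to \infty$ through the reals, $$\lim_{\alpha \to \infty}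 \frac{\mu_n(\alpha X)}{|\mathbb{Z}^n \cap \alpha X|} = 1 \qquad \text{and} \qquad \lim_{\alpha \to \infty} \frac{b(\alpha X)}{|\partial_e(\mathbb{Z}^n \cap \alpha X)|} = 1 .$$ -/

import Mathlib

open Filter Topology MeasureTheory
open scoped Pointwise

noncomputable section

namespace PL

/-- The inclusion of the integer lattice into real `n`-space. -/
def toReal {n : ℕ} (u : Fin n → ℤ) : Fin n → ℝ := fun i => (u i : ℝ)

/-- `G` is a PL (primitive lattice) graph on the integer lattice whose edges are given by the
pairwise distinct integer vectors `v 0, …, v (k - 1)`. -/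
structure IsPLGraph {n k : ℕ} (G : SimpleGraph (Fin n → ℤ)) (v : Fin k → Fin n → ℤ) : Prop where
  injective : Function.Injective v
  ne_neg : ∀ i j, v i ≠ -v j
  adj_iff : ∀ u w, G.Adj u w ↔ ∃ i, w = u + v i ∨ w = u - v i
  primitive : ∀ i, Finset.univ.gcd (v i) = 1
  span_eq_top : Submodule.span ℝ (Set.range fun i => toReal (v i)) = ⊤

/-- The edge boundary of a vertex set `S`: the (undirected) edges with exactly one endpoint
in `S`. -/
def edgeBoundary {V : Type*} (G : SimpleGraph V) (S : Set V) : Set (Sym2 V) :=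
  {e | e ∈ G.edgeSet ∧ ({x | x ∈ e} ∩ S).ncard = 1}

/-- The edge segment from the origin to the integer vector `w`. -/
def edgeSegment {n : ℕ} (w : Fin n → ℤ) : Set (Fin n → ℝ) := segment ℝ 0 (toReal w)

/-- The zonotope: the Minkowski sum of all `-ℓ i + ℓ i`, where `ℓ i` are the edge segments. -/
def zonotope {n k : ℕ} (v : Fin k → Fin n → ℤ) : Set (Fin n → ℝ) :=
  ∑ i, (-edgeSegment (v i) + edgeSegment (v i))

/-- The difference quotient `(μ (A + ε Z) - μ A) / ε`. -/
def boundaryQuotient {n : ℕ} (Z A : Set (Fin n → ℝ)) (ε : ℝ) : ℝ :=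
  (volume.real (A + ε • Z) - volume.real A) / ε

/-- The boundary functional: the limit of the difference quotient as `ε` decreases to `0`. It is
meaningful where that limit exists. -/
def boundary {n : ℕ} (Z A : Set (Fin n → ℝ)) : ℝ :=
  limUnder (𝓝[>] (0 : ℝ)) (boundaryQuotient Z A)

/-- The lattice points of a subset of real `n`-space. -/
def latticePoints {n : ℕ} (A : Set (Fin n → ℝ)) : Set (Fin n → ℤ) := {u | toReal u ∈ A}

end PL

end

/-!
The proof compares two ways of sweeping a convex body `X` along a vector `w`.

In the continuous setting, let `c w = vol (X + [0, w]) - vol X` (`sweepGain`). The part of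
`X + [0, (s + t) w]` outside `X + [0, s w]` is a translate of the part of `X + [0, t w]` outside
`X`, so that `vol (X + [0, t w]) = vol X + t * c w` exactly, for all `t ≥ 0`
(`measureReal_add_segment_smul`). Hence `c w` is the slope at infinity of this volume, which makes
it monotone in `X` (`sweepGain_mono`). Since `X + ε B` lies between `X` and a translate of
`(1 + O(ε)) X`, the gain of `X + ε B` tends to that of `X`. The zonotope is the sum of the segments
`[0, ± v i]`. Adding its segments one at a time shows that the boundary functional of `X` exists
and equals the sum of `c w` over the `2 k` steps `w = ± v i`
(`tendsto_measureReal_add_smul_sum_segment_sub_div`). It is homogeneous of degree `n - 1`.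

In the discrete setting, let `S` be the set of lattice points of `α X`, and let `N w` be the number
of `u ∈ S` with `u + w ∉ S` (`exits`). By convexity `S` has no gaps in direction `w`, so the set
`S + {0, w, …, m w}` has exactly `|S| + m * N w` points (`ncard_multiples`), and the edge boundary
of `S` has `∑ w, N w` edges over the same `2 k` steps (`ncard_edgeBoundary`).

With `m = ⌊α⌋` the two sweeps agree up to a bounded error: attaching a unit cube to each lattice
point shows that `|S + {0, w, …, m w}|` lies between the volumes of `(α ± κ) X + [0, α w]` for a
constant `κ` (`ncard_multiples_latticePoints_le`, `le_ncard_multiples_latticePoints`). Dividing by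
`α ^ n` yields `|S| / α ^ n → vol X` and `N w / α ^ (n - 1) → c w`. Both limits of the theorem
follow, because `vol X > 0` and each `c w > 0`. No coordinates adapted to `w` are needed.
-/

namespace PL

/-! ### Sweeping a convex body along a segment -/

section Sweep

theorem preimage_add_left_add {G : Type*} [AddCommGroup G] (a : G) (X S : Set G) :
    (fun p => a + p) ⁻¹' X + S = (fun p => a + p) ⁻¹' (X + S) := by
  ext p
  simp only [Set.mem_preimage, Set.mem_add]
  constructor
  · rintro ⟨x, hx, y, hy, rfl⟩
    exact ⟨a + x, hx, y, hy, by abel⟩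
  · rintro ⟨x, hx, y, hy, h⟩
    exact ⟨-a + x, by simpa using hx, y, hy, by rw [add_assoc, h]; abel⟩

variable {E : Type*} [NormedAddCommGroup E] [NormedSpace ℝ E]

theorem mem_add_segment_zero_smul_iff {X : Set E} {w p : E} {t : ℝ} (ht : 0 ≤ t) :
    p ∈ X + segment ℝ 0 (t • w) ↔ ∃ r, 0 ≤ r ∧ r ≤ t ∧ p - r • w ∈ X := by
  constructor
  · rintro ⟨x, hx, y, hy, rfl⟩
    rw [segment_eq_image] at hy
    obtain ⟨θ, ⟨h0, h1⟩, rfl⟩ := hy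
    refine ⟨θ * t, by positivity, by nlinarith, ?_⟩
    simpa [smul_smul] using hx
  · rintro ⟨r, h0, h1, hp⟩
    refine ⟨_, hp, r • w, ?_, by simp⟩
    rw [segment_eq_image]
    rcases ht.eq_or_lt with rfl | ht
    · obtain rfl : r = 0 := le_antisymm h1 h0
      exact ⟨0, by simp, by simp⟩
    · refine ⟨r / t, ⟨by positivity, by rw [div_le_one ht]; exact h1⟩, ?_⟩
      simp [smul_smul, div_mul_cancel₀ _ ht.ne']

theorem smul_segment_zero (β : ℝ) (w : E) : β • segment ℝ 0 w = segment ℝ 0 (β • w) := by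
  refine (image_segment ℝ (LinearMap.lsmul ℝ E β).toAffineMap 0 w).trans ?_
  simp

theorem isBounded_segment (x y : E) : Bornology.IsBounded (segment ℝ x y) := by
  rw [← convexHull_pair, isBounded_convexHull]
  exact (Set.toFinite _).isBounded

/-- A point of a dilate of `X` stays in a slightly larger dilate after a bounded perturbation,
up to a fixed multiple of the centre of a ball contained in `X`. -/
theorem add_add_smul_mem_smul {X : Set E} (hX : Convex ℝ X) {x₀ : E} {ρ : ℝ} (hρ : 0 < ρ)
    (hball : Metric.closedBall x₀ ρ ⊆ X) {β R : ℝ} (hβ : 0 ≤ β) (hR : 0 < R) {x z : E}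
    (hx : x ∈ β • X) (hz : ‖z‖ ≤ R) : x + z + (R / ρ) • x₀ ∈ (β + R / ρ) • X := by
  have hc : 0 < R / ρ := by positivity
  rw [hX.add_smul hβ hc.le]
  refine ⟨x, hx, (R / ρ) • (x₀ + (R / ρ)⁻¹ • z), Set.smul_mem_smul_set (hball ?_), ?_⟩
  · rw [mem_closedBall_iff_norm, add_sub_cancel_left, norm_smul, norm_inv, Real.norm_eq_abs,
      abs_of_pos hc, inv_div, div_mul_eq_mul_div, div_le_iff₀ hR]
    gcongr
  · simp only [smul_add, smul_smul, mul_inv_cancel₀ hc.ne', one_smul]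
    abel

omit [NormedSpace ℝ E] in
theorem isBounded_preimage_add_left (a : E) {X : Set E} (hb : Bornology.IsBounded X) :
    Bornology.IsBounded ((fun p => a + p) ⁻¹' X) :=
  (IsometryEquiv.addLeft a).isometry.antilipschitz.isBounded_preimage hb

variable [MeasurableSpace E] (μ : Measure E)

/-- The increase of the measure of `X` when `X` is swept along the segment from `0` to `w`. For a
convex body in Euclidean space this is the length of `w` times the volume of the projection of `X`
along `w`. -/
noncomputable def sweepGain (X : Set E) (w : E) : ℝ := μ.real (X + segment ℝ 0 w) - μ.real X

variable [BorelSpace E] [FiniteDimensional ℝ E] [μ.IsAddHaarMeasure]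

theorem measureReal_preimage_add_left {G : Type*} [MeasurableSpace G] [AddGroup G]
    [MeasurableAdd G] (μ : Measure G) [μ.IsAddLeftInvariant] (a : G) (X : Set G) :
    μ.real ((fun p => a + p) ⁻¹' X) = μ.real X := by
  simp only [measureReal_def, measure_preimage_add]

theorem measureReal_mono_of_isBounded {M : Type*} [PseudoMetricSpace M] [ProperSpace M]
    [MeasurableSpace M] (μ : Measure M) [IsFiniteMeasureOnCompacts μ] {X Y : Set M} (h : X ⊆ Y)
    (hY : Bornology.IsBounded Y) : μ.real X ≤ μ.real Y :=
  measureReal_mono h hY.measure_lt_top.ne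

/-- Consecutive sweeps of a convex set gain independently: the part added by the sweep from `s` to
`s + t` is a translate of the part added by the sweep from `0` to `t`. -/
theorem sweepGain_add_smul {X : Set E} (hX : Convex ℝ X) (hb : Bornology.IsBounded X) (w : E)
    {s t : ℝ} (hs : 0 ≤ s) (ht : 0 ≤ t) :
    sweepGain μ X ((s + t) • w) = sweepGain μ X (s • w) + sweepGain μ X (t • w) := by
  have hst : 0 ≤ s + t := add_nonneg hs ht
  have hbd : ∀ r : ℝ, Bornology.IsBounded (X + segment ℝ 0 (r • w)) :=
    fun r => hb.add (isBounded_segment _ _)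
  have hcv : ∀ r : ℝ, NullMeasurableSet (X + segment ℝ 0 (r • w)) μ :=
    fun r => (hX.add (convex_segment _ _)).nullMeasurableSet μ
  have hsub : X + segment ℝ 0 (s • w) ⊆ X + segment ℝ 0 ((s + t) • w) := by
    intro p hp
    rw [mem_add_segment_zero_smul_iff hs] at hp
    rw [mem_add_segment_zero_smul_iff hst]
    obtain ⟨r, h0, h1, h⟩ := hp
    exact ⟨r, h0, by linarith, h⟩
  have hsub' : X ⊆ X + segment ℝ 0 (t • w) := by
    intro p hp
    rw [mem_add_segment_zero_smul_iff ht]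
    exact ⟨0, le_rfl, ht, by simpa using hp⟩
  have key : (X + segment ℝ 0 ((s + t) • w)) \ (X + segment ℝ 0 (s • w)) =
      (fun p => -(s • w) + p) ⁻¹' ((X + segment ℝ 0 (t • w)) \ X) := by
    ext p
    simp only [Set.mem_sdiff, Set.mem_preimage, mem_add_segment_zero_smul_iff hs,
      mem_add_segment_zero_smul_iff ht, mem_add_segment_zero_smul_iff hst]
    constructor
    · rintro ⟨⟨r, h0, h1, hr⟩, hn⟩
      have hsr : s < r := by
        by_contra! h
        exact hn ⟨r, h0, h, hr⟩
      refine ⟨⟨r - s, by linarith, by linarith, ?_⟩, fun h => hn ⟨s, hs, le_rfl, ?_⟩⟩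
      · convert hr using 1
        module
      · convert h using 1
        module
    · rintro ⟨⟨r, h0, h1, hr⟩, hn⟩
      refine ⟨⟨s + r, by linarith, by linarith, ?_⟩, ?_⟩
      · convert hr using 1
        module
      · rintro ⟨q, hq0, hqs, hq⟩
        apply hn
        -- `p - s • w` lies on the segment between the points `p - q • w` and `p - (s + r) • w`
        -- of `X`, as `q ≤ s ≤ s + r`.
        rcases (show 0 ≤ s - q + r by linarith).eq_or_lt with h | h
        · convert hq using 1
          rw [show q = s by linarith]
          abel
        · have hmem := hX.add_smul_sub_mem hq hr (t := (s - q) / (s - q + r))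
            ⟨by apply div_nonneg <;> linarith, by rw [div_le_one h]; linarith⟩
          convert hmem using 1
          have e : -(s • w) + p - r • w - (p - q • w) = (-(s - q + r)) • w := by module
          rw [e, smul_smul, mul_neg, div_mul_cancel₀ _ h.ne']
          module
  have h1 := measureReal_inter_add_sdiff₀ (μ := μ) (s := X + segment ℝ 0 ((s + t) • w))
    (hcv s) (hbd _).measure_lt_top.ne
  have h2 := measureReal_inter_add_sdiff₀ (μ := μ) (s := X + segment ℝ 0 (t • w))
    (hX.nullMeasurableSet μ) (hbd _).measure_lt_top.ne
  rw [key, measureReal_preimage_add_left, Set.inter_eq_right.2 hsub] at h1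
  rw [Set.inter_eq_right.2 hsub'] at h2
  simp only [sweepGain]
  linarith

omit [BorelSpace E] in
theorem sweepGain_nonneg {X : Set E} (hb : Bornology.IsBounded X) (w : E) :
    0 ≤ sweepGain μ X w := by
  refine sub_nonneg.2 (measureReal_mono_of_isBounded μ ?_ (hb.add (isBounded_segment _ _)))
  exact fun p hp => ⟨p, hp, 0, left_mem_segment _ _ _, by simp⟩

/-- An additive nonnegative function on the half-line is linear. -/
theorem eq_mul_of_additive_of_nonneg {g : ℝ → ℝ} (hg : ∀ t, 0 ≤ t → 0 ≤ g t)
    (hadd : ∀ s t, 0 ≤ s → 0 ≤ t → g (s + t) = g s + g t) {t : ℝ} (ht : 0 ≤ t) :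
    g t = t * g 1 := by
  have hmul : ∀ (N : ℕ) (s : ℝ), 0 ≤ s → g (N * s) = N * g s := by
    intro N s hs
    induction N with
    | zero => have := hadd 0 0 le_rfl le_rfl; simp at this ⊢; exact this
    | succ N ih => push_cast; rw [add_mul, one_mul, hadd _ _ (by positivity) hs, ih]; ring
  have hmono : ∀ s r, 0 ≤ s → s ≤ r → g s ≤ g r := by
    intro s r hs hr
    have := hadd s (r - s) hs (by linarith)
    rw [add_sub_cancel] at this
    linarith [hg (r - s) (by linarith)]
  have hbound : ∀ N : ℕ, (N : ℝ) * |g t - t * g 1| ≤ g 1 := by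
    intro N
    have hNt : 0 ≤ N * t := by positivity
    have h1 := hmono _ _ (by positivity) (Nat.floor_le hNt)
    have h2 := hmono _ _ hNt (Nat.lt_floor_add_one (N * t)).le
    have h3 := hmul ⌊N * t⌋₊ 1 zero_le_one
    have h4 := hmul (⌊N * t⌋₊ + 1) 1 zero_le_one
    rw [mul_one] at h3 h4
    push_cast at h4
    rw [hmul N t ht] at h1 h2
    rw [h3] at h1
    rw [h4] at h2
    have hg1 := hg 1 zero_le_one
    have h5 := mul_le_mul_of_nonneg_right (Nat.floor_le hNt) hg1
    have h6 := mul_le_mul_of_nonneg_right (Nat.lt_floor_add_one (N * t)).le hg1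
    rw [← Nat.abs_cast N, ← abs_mul, abs_le]
    constructor <;> linarith
  by_contra hne
  have hpos : 0 < |g t - t * g 1| := abs_pos.2 (sub_ne_zero.2 hne)
  obtain ⟨N, hN⟩ := exists_nat_gt (g 1 / |g t - t * g 1|)
  rw [div_lt_iff₀ hpos] at hN
  linarith [hbound N]

theorem sweepGain_smul {X : Set E} (hX : Convex ℝ X) (hb : Bornology.IsBounded X) (w : E)
    {t : ℝ} (ht : 0 ≤ t) : sweepGain μ X (t • w) = t * sweepGain μ X w := by
  have := eq_mul_of_additive_of_nonneg (g := fun t => sweepGain μ X (t • w))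
    (fun t _ => sweepGain_nonneg μ hb _) (fun s t hs ht => sweepGain_add_smul μ hX hb w hs ht) ht
  simpa using this

theorem measureReal_add_segment_smul {X : Set E} (hX : Convex ℝ X) (hb : Bornology.IsBounded X)
    (w : E) {t : ℝ} (ht : 0 ≤ t) :
    μ.real (X + segment ℝ 0 (t • w)) = μ.real X + t * sweepGain μ X w := by
  rw [← sweepGain_smul μ hX hb w ht, sweepGain]
  ring

/-- The gain is monotone in the convex set, because it is the slope at infinity of the measure of
the swept set. -/
theorem sweepGain_mono {X Y : Set E} (hX : Convex ℝ X) (hY : Convex ℝ Y)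
    (hb : Bornology.IsBounded Y) (h : X ⊆ Y) (w : E) : sweepGain μ X w ≤ sweepGain μ Y w := by
  by_contra! hlt
  have hpos : 0 < sweepGain μ X w - sweepGain μ Y w := sub_pos.2 hlt
  obtain ⟨N, hN⟩ := exists_nat_gt ((μ.real Y - μ.real X) / (sweepGain μ X w - sweepGain μ Y w))
  rw [div_lt_iff₀ hpos] at hN
  have := measureReal_mono_of_isBounded μ
    (Set.add_subset_add h (Set.Subset.refl (segment ℝ 0 ((N : ℝ) • w))))
    (hb.add (isBounded_segment _ _))
  rw [measureReal_add_segment_smul μ hX (hb.subset h) w N.cast_nonneg,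
    measureReal_add_segment_smul μ hY hb w N.cast_nonneg] at this
  linarith

omit [FiniteDimensional ℝ E] in
theorem sweepGain_preimage_add_left (a : E) (X : Set E) (w : E) :
    sweepGain μ ((fun p => a + p) ⁻¹' X) w = sweepGain μ X w := by
  rw [sweepGain, preimage_add_left_add, measureReal_preimage_add_left,
    measureReal_preimage_add_left, sweepGain]

theorem measureReal_smul_of_nonneg {β : ℝ} (hβ : 0 ≤ β) (X : Set E) :
    μ.real (β • X) = β ^ Module.finrank ℝ E * μ.real X := by
  rw [measureReal_def, Measure.addHaar_smul_of_nonneg μ hβ, ENNReal.toReal_mul,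
    ENNReal.toReal_ofReal (by positivity), measureReal_def]

theorem sweepGain_smul_set {X : Set E} (hX : Convex ℝ X) (hb : Bornology.IsBounded X) (w : E)
    {β : ℝ} (hβ : 0 < β) :
    sweepGain μ (β • X) w = β ^ Module.finrank ℝ E * (β⁻¹ * sweepGain μ X w) := by
  have h : β • X + segment ℝ 0 w = β • (X + segment ℝ 0 (β⁻¹ • w)) := by
    rw [smul_add, smul_segment_zero, smul_inv_smul₀ hβ.ne']
  rw [sweepGain, h, measureReal_smul_of_nonneg μ hβ.le, measureReal_smul_of_nonneg μ hβ.le,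
    measureReal_add_segment_smul μ hX hb w (inv_nonneg.2 hβ.le)]
  ring

/-- If sweeping gained nothing, all the sets `X + [0, t • w]` would have the measure of `X`, while
they contain two disjoint translates of `X` for large `t`. -/
theorem sweepGain_pos {X : Set E} (hX : Convex ℝ X) (hb : Bornology.IsBounded X)
    (hint : (interior X).Nonempty) {w : E} (hw : w ≠ 0) : 0 < sweepGain μ X w := by
  refine (sweepGain_nonneg μ hb w).lt_of_ne fun h0 => ?_
  obtain ⟨M, hM⟩ := hb.exists_norm_le
  have hw' : 0 < ‖w‖ := norm_pos_iff.2 hw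
  obtain ⟨N, hN⟩ := exists_nat_gt ((M + M) / ‖w‖)
  rw [div_lt_iff₀ hw'] at hN
  have hsub : X ∪ (fun p => -((N : ℝ) • w) + p) ⁻¹' X ⊆ X + segment ℝ 0 ((N : ℝ) • w) := by
    rintro p (hp | hp)
    · exact ⟨p, hp, 0, left_mem_segment _ _ _, by simp⟩
    · exact ⟨_, hp, _, right_mem_segment _ _ _, by simp⟩
  have hdis : Disjoint X ((fun p => -((N : ℝ) • w) + p) ⁻¹' X) := by
    rw [Set.disjoint_left]
    intro p hp hp'
    have h1 := hM _ hp
    have h2 := hM _ hp'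
    have h3 : (N : ℝ) • w = p - (-((N : ℝ) • w) + p) := by abel
    have h4 : ‖(N : ℝ) • w‖ ≤ M + M := by
      rw [h3]
      exact (norm_sub_le _ _).trans (add_le_add h1 h2)
    rw [norm_smul, Real.norm_eq_abs, Nat.abs_cast] at h4
    linarith
  have hbd := hb.add (isBounded_segment 0 ((N : ℝ) • w))
  have h1 := measureReal_mono_of_isBounded μ hsub hbd
  have hbp : Bornology.IsBounded ((fun p => -((N : ℝ) • w) + p) ⁻¹' X) :=
    hbd.subset (Set.subset_union_right.trans hsub)
  rw [measureReal_union₀' (hX.nullMeasurableSet μ) hdis.aedisjoint hb.measure_lt_top.ne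
    hbp.measure_lt_top.ne, measureReal_preimage_add_left,
    measureReal_add_segment_smul μ hX hb w N.cast_nonneg, ← h0] at h1
  have h2 : 0 < μ.real X := ENNReal.toReal_pos
    (Measure.measure_pos_of_nonempty_interior μ hint).ne' hb.measure_lt_top.ne
  linarith

end Sweep

/-! ### The first variation of volume under Minkowski addition of a sum of segments -/

section FirstVariation

variable {E : Type*} [NormedAddCommGroup E] [NormedSpace ℝ E] [MeasurableSpace E] (μ : Measure E)
  [BorelSpace E] [FiniteDimensional ℝ E] [μ.IsAddHaarMeasure]

/-- The gain is continuous along `X + ε • B` as `ε` decreases to `0`: this set contains `X` and is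
contained in a translate of `(1 + O(ε)) • X`. -/
theorem tendsto_sweepGain_add_smul {X B : Set E} (hX : Convex ℝ X) (hb : Bornology.IsBounded X)
    (hint : (interior X).Nonempty) (hB : Convex ℝ B) (hBb : Bornology.IsBounded B)
    (hB0 : (0 : E) ∈ B) (w : E) :
    Tendsto (fun ε : ℝ => sweepGain μ (X + ε • B) w) (𝓝[>] 0) (𝓝 (sweepGain μ X w)) := by
  obtain ⟨x₀, hx₀⟩ := hint
  obtain ⟨ρ, hρ, hball⟩ := Metric.nhds_basis_closedBall.mem_iff.1 (mem_interior_iff_mem_nhds.1 hx₀)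
  obtain ⟨R, hR, hRB⟩ := hBb.exists_pos_norm_le
  have hlim : Tendsto (fun ε : ℝ => (1 + ε * R / ρ) ^ Module.finrank ℝ E *
      ((1 + ε * R / ρ)⁻¹ * sweepGain μ X w)) (𝓝[>] 0) (𝓝 (sweepGain μ X w)) := by
    have hc : ContinuousAt (fun ε : ℝ => (1 + ε * R / ρ) ^ Module.finrank ℝ E *
        ((1 + ε * R / ρ)⁻¹ * sweepGain μ X w)) 0 := by
      have h1 : ContinuousAt (fun ε : ℝ => 1 + ε * R / ρ) 0 := by fun_prop
      exact (h1.pow _).mul ((h1.inv₀ (by simp)).mul continuousAt_const)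
    simpa using hc.tendsto.mono_left nhdsWithin_le_nhds
  refine tendsto_of_tendsto_of_tendsto_of_le_of_le' tendsto_const_nhds hlim ?_ ?_
  · refine .of_forall fun ε => sweepGain_mono μ hX (hX.add (hB.smul ε)) (hb.add (hBb.smul₀ ε)) ?_ w
    exact fun p hp => ⟨p, hp, 0, ⟨0, hB0, smul_zero _⟩, add_zero _⟩
  · filter_upwards [self_mem_nhdsWithin] with ε hε
    have hε : 0 < ε := hε
    have hpos : 0 < 1 + ε * R / ρ := by positivity
    rw [← sweepGain_smul_set μ hX hb w hpos,
      ← sweepGain_preimage_add_left μ ((ε * R / ρ) • x₀) ((1 + ε * R / ρ) • X)]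
    refine sweepGain_mono μ (hX.add (hB.smul ε)) ?_ ?_ ?_ w
    · exact (hX.smul _).translate_preimage_right _
    · exact isBounded_preimage_add_left _ (hb.smul₀ _)
    · rintro _ ⟨x, hx, _, ⟨b, hbB, rfl⟩, rfl⟩
      have := add_add_smul_mem_smul hX hρ hball zero_le_one (mul_pos hε hR) (x := x) (z := ε • b)
        (by simpa using hx) (by
          rw [norm_smul, Real.norm_of_nonneg hε.le]
          exact mul_le_mul_of_nonneg_left (hRB b hbB) hε.le)
      rw [Set.mem_preimage, add_comm ((ε * R / ρ) • x₀)]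
      exact this

/-- Adding the segments one at a time, each contributes the gain of `X` in its direction to the
derivative at `0`. -/
theorem tendsto_measureReal_add_smul_sum_segment_sub_div {ι : Type*} {X : Set E} (hX : Convex ℝ X)
    (hb : Bornology.IsBounded X) (hint : (interior X).Nonempty) (s : Finset ι) (w : ι → E) :
    Tendsto (fun ε : ℝ => (μ.real (X + ε • ∑ i ∈ s, segment ℝ 0 (w i)) - μ.real X) / ε) (𝓝[>] 0)
      (𝓝 (∑ i ∈ s, sweepGain μ X (w i))) := by
  classical
  induction s using Finset.induction_on with
  | empty => simp
  | insert j s hj ih =>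
    have hcv : Convex ℝ (∑ i ∈ s, segment ℝ 0 (w i)) := convex_sum _ fun _ _ => convex_segment _ _
    have hbd : Bornology.IsBounded (∑ i ∈ s, segment ℝ 0 (w i)) :=
      Finset.sum_induction _ Bornology.IsBounded (fun _ _ => Bornology.IsBounded.add)
        Bornology.isBounded_singleton fun _ _ => isBounded_segment _ _
    have h0 : (0 : E) ∈ ∑ i ∈ s, segment ℝ 0 (w i) :=
      Finset.sum_induction _ (fun S : Set E => (0 : E) ∈ S)
        (fun _ _ ha hb => ⟨0, ha, 0, hb, add_zero _⟩) rfl fun _ _ => left_mem_segment _ _ _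
    rw [Finset.sum_insert hj (f := fun i => sweepGain μ X (w i)), add_comm (sweepGain μ X (w j))]
    refine (ih.add (tendsto_sweepGain_add_smul μ hX hb hint hcv hbd h0 (w j))).congr' ?_
    filter_upwards [self_mem_nhdsWithin] with ε hε
    have hε : 0 < ε := hε
    rw [Finset.sum_insert hj, smul_add, smul_segment_zero, add_comm (segment ℝ 0 _), ← add_assoc,
      measureReal_add_segment_smul μ (hX.add (hcv.smul ε)) (hb.add (hbd.smul₀ ε)) (w j) hε.le]
    field_simp
    ring

end FirstVariation

/-! ### Edge boundaries and sweeps of lattice sets -/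

section Discrete

/-- The points of `S` that leave `S` when translated by `w`. -/
def exits {V : Type*} [Add V] (S : Set V) (w : V) : Set V := {u | u ∈ S ∧ u + w ∉ S}

/-- The union of the translates of `S` by `0, w, …, m • w`. -/
def multiples {V : Type*} [AddCommGroup V] (S : Set V) (w : V) (m : ℕ) : Set V :=
  {p | ∃ j : ℕ, j ≤ m ∧ p - j • w ∈ S}

variable {V : Type*} [AddCommGroup V]

theorem multiples_zero (S : Set V) (w : V) : multiples S w 0 = S := by
  ext p
  simp [multiples]

theorem finite_multiples {S : Set V} (hS : S.Finite) (w : V) (m : ℕ) :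
    (multiples S w m).Finite := by
  refine ((Set.finite_Iic m).image2 (fun (j : ℕ) u => u + j • w) hS).subset ?_
  rintro p ⟨j, hj, hp⟩
  exact ⟨j, hj, _, hp, sub_add_cancel _ _⟩

/-- If `S` has no gaps in direction `w`, each further translate adds one point for every
`w`-progression that meets `S`, and these progressions are counted by `exits S w`. -/
theorem ncard_multiples {S : Set V} (hS : S.Finite) {w : V}
    (hgap : ∀ u ∈ S, ∀ l : ℕ, u + (l + 1) • w ∈ S → u + w ∈ S) (m : ℕ) :
    (multiples S w m).ncard = S.ncard + m * (exits S w).ncard := by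
  induction m with
  | zero => simp [multiples_zero]
  | succ m ih =>
    have hfin : (exits S w).Finite := hS.subset fun u hu => hu.1
    have hun : multiples S w (m + 1) =
        multiples S w m ∪ (fun u => u + (m + 1) • w) '' exits S w := by
      ext p
      constructor
      · rintro ⟨j, hj, hp⟩
        rcases hj.lt_or_eq with h | rfl
        · exact Or.inl ⟨j, by omega, hp⟩
        · by_cases hex : p - (m + 1) • w + w ∈ S
          · refine Or.inl ⟨m, le_rfl, ?_⟩
            convert hex using 1
            rw [succ_nsmul]
            abel
          · exact Or.inr ⟨_, ⟨hp, hex⟩, sub_add_cancel _ _⟩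
      · rintro (⟨j, hj, hp⟩ | ⟨u, ⟨hu, -⟩, rfl⟩)
        · exact ⟨j, by omega, hp⟩
        · exact ⟨m + 1, le_rfl, by simpa using hu⟩
    have hdis : Disjoint (multiples S w m) ((fun u => u + (m + 1) • w) '' exits S w) := by
      rw [Set.disjoint_left]
      rintro _ ⟨j, hj, hp⟩ ⟨u, ⟨hu, hex⟩, rfl⟩
      obtain ⟨d, rfl⟩ := Nat.exists_eq_add_of_le hj
      refine hex (hgap u hu d ?_)
      convert hp using 1
      simp only [add_nsmul]
      abel
    rw [hun, Set.ncard_union_eq hdis (finite_multiples hS w m) (hfin.image _), ih,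
      Set.ncard_image_of_injective _ (add_left_injective _)]
    ring

/-- A boundary edge is determined by its endpoint in `S` and the step that leads out of `S`. -/
theorem ncard_edgeBoundary {ι : Type*} [Fintype ι] {G : SimpleGraph V} {w : ι → V}
    (hw : Function.Injective w) (hadj : ∀ u x, G.Adj u x ↔ ∃ j, x = u + w j)
    {S : Set V} (hS : S.Finite) :
    (edgeBoundary G S).ncard = ∑ j, (exits S (w j)).ncard := by
  classical
  have hfin : ∀ j, (exits S (w j)).Finite := fun j => hS.subset fun u hu => hu.1
  have hpair : ∀ x y, ({z | z ∈ s(x, y)} : Set V) = {x, y} := by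
    intro x y
    ext z
    simp
  let T : Finset ((_ : ι) × V) := Finset.univ.sigma fun j => (hfin j).toFinset
  have hT : ∀ j u, (⟨j, u⟩ : (_ : ι) × V) ∈ T ↔ u ∈ S ∧ u + w j ∉ S := by
    intro j u
    simp [T, exits]
  have himg : edgeBoundary G S = (fun q : (_ : ι) × V => s(q.2, q.2 + w q.1)) '' T := by
    ext e
    constructor
    · induction e using Sym2.ind with
      | _ x y =>
        rintro ⟨he, hcard⟩
        rw [SimpleGraph.mem_edgeSet] at he
        rw [hpair] at hcard
        by_cases hx : x ∈ S <;> by_cases hy : y ∈ S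
        · have : ({x, y} : Set V) ∩ S = {x, y} := by
            rw [Set.inter_eq_left]
            rintro z (rfl | rfl) <;> assumption
          rw [this, Set.ncard_pair he.ne] at hcard
          omega
        · obtain ⟨j, rfl⟩ := (hadj _ _).1 he
          exact ⟨⟨j, x⟩, (hT _ _).2 ⟨hx, hy⟩, rfl⟩
        · obtain ⟨j, rfl⟩ := (hadj _ _).1 he.symm
          exact ⟨⟨j, y⟩, (hT _ _).2 ⟨hy, hx⟩, Sym2.eq_swap⟩
        · have : ({x, y} : Set V) ∩ S = ∅ := by
            rw [Set.eq_empty_iff_forall_notMem]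
            rintro z ⟨rfl | rfl, hz⟩ <;> contradiction
          rw [this, Set.ncard_empty] at hcard
          omega
    · rintro ⟨⟨j, u⟩, hq, rfl⟩
      obtain ⟨hu, hex⟩ := (hT _ _).1 hq
      refine ⟨(SimpleGraph.mem_edgeSet _).2 ((hadj _ _).2 ⟨j, rfl⟩), ?_⟩
      have : ({u, u + w j} : Set V) ∩ S = {u} := by
        ext z
        constructor
        · rintro ⟨rfl | rfl, hz⟩
          · rfl
          · contradiction
        · rintro rfl
          exact ⟨Or.inl rfl, hu⟩
      rw [hpair]
      exact (congrArg Set.ncard this).trans (Set.ncard_singleton u)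
  have hinj : Set.InjOn (fun q : (_ : ι) × V => s(q.2, q.2 + w q.1)) T := by
    rintro ⟨j, u⟩ hq ⟨j', u'⟩ hq' h
    obtain ⟨hu, hex⟩ := (hT _ _).1 hq
    obtain ⟨hu', hex'⟩ := (hT _ _).1 hq'
    rcases Sym2.eq_iff.1 h with ⟨h1, h2⟩ | ⟨h1, h2⟩
    · obtain rfl : u = u' := h1
      obtain rfl : j = j' := hw (add_left_cancel h2)
      rfl
    · have h1 : u = u' + w j' := h1
      exact absurd (h1 ▸ hu) hex'
  rw [himg, hinj.ncard_image, Set.ncard_coe_finset, Finset.card_sigma]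
  exact Finset.sum_congr rfl fun j _ => (Set.ncard_eq_toFinset_card _ (hfin j)).symm

end Discrete

/-! ### Counting lattice points by unit cubes -/

section LatticePoints

variable {n : ℕ}

/-- The lattice vector of coordinatewise integer parts. Its fibres are the half-open unit cubes
with lattice corners. -/
noncomputable def floorVec (x : Fin n → ℝ) : Fin n → ℤ := fun i => ⌊x i⌋

theorem norm_sub_floorVec_le (x : Fin n → ℝ) : ‖x - toReal (floorVec x)‖ ≤ 1 := by
  rw [pi_norm_le_iff_of_nonneg zero_le_one]
  intro i
  change ‖x i - ⌊x i⌋‖ ≤ 1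
  rw [Int.self_sub_floor, Real.norm_of_nonneg (Int.fract_nonneg _)]
  exact (Int.fract_lt_one _).le

theorem floorVec_preimage_singleton (u : Fin n → ℤ) :
    floorVec ⁻¹' {u} = Set.univ.pi fun i => Set.Ico (u i : ℝ) (u i + 1) := by
  ext x
  simp [funext_iff, floorVec, Int.floor_eq_iff]

theorem volume_floorVec_preimage {T : Set (Fin n → ℤ)} (hT : T.Finite) :
    volume (floorVec ⁻¹' T) = T.ncard := by
  have h : floorVec ⁻¹' T = ⋃ u ∈ hT.toFinset, floorVec ⁻¹' {u} := by
    ext x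
    simp
  rw [h, measure_biUnion_finset]
  · simp only [floorVec_preimage_singleton, Real.volume_pi_Ico]
    simp [Set.ncard_eq_toFinset_card T hT]
  · intro u _ u' _ hne
    exact Disjoint.preimage _ (Set.disjoint_singleton.2 hne)
  · intro u _
    rw [floorVec_preimage_singleton]
    exact MeasurableSet.univ_pi fun _ => measurableSet_Ico

theorem toReal_add (u w : Fin n → ℤ) : toReal (u + w) = toReal u + toReal w := by
  ext i
  simp [toReal]

theorem toReal_sub (u w : Fin n → ℤ) : toReal (u - w) = toReal u - toReal w := by
  ext i
  simp [toReal]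

theorem toReal_neg (u : Fin n → ℤ) : toReal (-u) = -toReal u := by
  ext i
  simp [toReal]

theorem toReal_nsmul (j : ℕ) (w : Fin n → ℤ) : toReal (j • w) = (j : ℝ) • toReal w := by
  ext i
  simp [toReal]

theorem toReal_ne_zero {w : Fin n → ℤ} (hw : w ≠ 0) : toReal w ≠ 0 := by
  contrapose! hw
  ext i
  simpa [toReal] using congrFun hw i

theorem finite_latticePoints {A : Set (Fin n → ℝ)} (hA : Bornology.IsBounded A) :
    (latticePoints A).Finite := by
  obtain ⟨M, hM⟩ := hA.exists_norm_le
  refine (Set.finite_Icc (fun _ => -⌈M⌉) fun _ => ⌈M⌉).subset fun u hu => ?_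
  have h : ∀ i, |(u i : ℝ)| ≤ ⌈M⌉ := fun i =>
    ((norm_le_pi_norm (toReal u) i).trans (hM _ hu)).trans (Int.le_ceil M)
  constructor <;> intro i
  · exact_mod_cast (abs_le.1 (h i)).1
  · exact_mod_cast (abs_le.1 (h i)).2

theorem add_mem_latticePoints {A : Set (Fin n → ℝ)} (hA : Convex ℝ A) (u w : Fin n → ℤ)
    (hu : u ∈ latticePoints A) (l : ℕ) (hl : u + (l + 1) • w ∈ latticePoints A) :
    u + w ∈ latticePoints A := by
  have h1 : toReal u + ((l + 1 : ℕ) : ℝ) • toReal w ∈ A := by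
    rw [← toReal_nsmul, ← toReal_add]
    exact hl
  have hpos : (0 : ℝ) < ((l + 1 : ℕ) : ℝ) := by positivity
  have h2 := hA.add_smul_mem hu h1 (t := ((l + 1 : ℕ) : ℝ)⁻¹)
    ⟨by positivity, inv_le_one_of_one_le₀ (by simp)⟩
  rw [inv_smul_smul₀ hpos.ne', ← toReal_add] at h2
  exact h2

variable {X : Set (Fin n → ℝ)} {x₀ : Fin n → ℝ} {ρ : ℝ}

theorem ncard_multiples_latticePoints_le (hX : Convex ℝ X) (hb : Bornology.IsBounded X)
    (hρ : 0 < ρ) (hball : Metric.closedBall x₀ ρ ⊆ X) (w : Fin n → ℤ) {α t : ℝ} (hα : 0 ≤ α)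
    (ht : 0 ≤ t) :
    ((multiples (latticePoints (α • X)) w ⌊t⌋₊).ncard : ℝ) ≤
      volume.real ((α + (‖toReal w‖ + 1) / ρ) • X + segment ℝ 0 (t • toReal w)) := by
  set κ := (‖toReal w‖ + 1) / ρ with hκ
  have hT := finite_multiples (finite_latticePoints (hb.smul₀ α)) w ⌊t⌋₊
  rw [← ENNReal.toReal_natCast, ← volume_floorVec_preimage hT,
    ← measureReal_preimage_add_left volume (κ • x₀) ((α + κ) • X + _)]
  refine measureReal_mono_of_isBounded volume ?_
    (isBounded_preimage_add_left _ ((hb.smul₀ _).add (isBounded_segment _ _)))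
  rintro x ⟨j, hj, hx⟩
  rw [Set.mem_preimage, mem_add_segment_zero_smul_iff ht]
  refine ⟨j, j.cast_nonneg, (Nat.le_floor_iff ht).1 hj, ?_⟩
  have h := add_add_smul_mem_smul hX hρ hball hα (R := ‖toReal w‖ + 1) (by positivity) hx
    (z := x - toReal (floorVec x))
    ((norm_sub_floorVec_le x).trans (by linarith [norm_nonneg (toReal w)]))
  rw [toReal_sub, toReal_nsmul, ← hκ] at h
  convert h using 1
  abel

/-- Every real point of the slightly shrunk sweep has its integer part in `multiples`: rounding
both the point and its position along the sweep moves the base point by at most `‖w‖ + 1`. -/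
theorem le_ncard_multiples_latticePoints (hX : Convex ℝ X) (hb : Bornology.IsBounded X)
    (hρ : 0 < ρ) (hball : Metric.closedBall x₀ ρ ⊆ X) (w : Fin n → ℤ) {α t : ℝ}
    (hα : (‖toReal w‖ + 1) / ρ ≤ α) (ht : 0 ≤ t) :
    volume.real ((α + -((‖toReal w‖ + 1) / ρ)) • X + segment ℝ 0 (t • toReal w)) ≤
      ((multiples (latticePoints (α • X)) w ⌊t⌋₊).ncard : ℝ) := by
  set κ := (‖toReal w‖ + 1) / ρ with hκ
  have hT := finite_multiples (finite_latticePoints (hb.smul₀ α)) w ⌊t⌋₊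
  rw [← ENNReal.toReal_natCast, ← volume_floorVec_preimage hT,
    ← measureReal_preimage_add_left volume (-(κ • x₀)) ((α + -κ) • X + _)]
  refine measureReal_mono ?_ (by rw [volume_floorVec_preimage hT]; exact ENNReal.natCast_ne_top _)
  intro x hx
  rw [Set.mem_preimage, mem_add_segment_zero_smul_iff ht] at hx
  obtain ⟨r, hr0, hrt, hr⟩ := hx
  refine ⟨⌊r⌋₊, Nat.floor_mono hrt, ?_⟩
  have hfr : ‖(r - ⌊r⌋₊) • toReal w - (x - toReal (floorVec x))‖ ≤ ‖toReal w‖ + 1 := by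
    refine (norm_sub_le _ _).trans (add_le_add ?_ (norm_sub_floorVec_le x))
    rw [norm_smul, Real.norm_of_nonneg (sub_nonneg.2 (Nat.floor_le hr0))]
    exact mul_le_of_le_one_left (norm_nonneg _) (by linarith [Nat.lt_floor_add_one r])
  have h := add_add_smul_mem_smul hX hρ hball (by linarith) (by positivity) hr hfr
  rw [← hκ, neg_add_cancel_right] at h
  change toReal _ ∈ α • X
  rw [toReal_sub, toReal_nsmul]
  convert h using 1
  module

theorem volume_smul_add_segment_smul (hX : Convex ℝ X) (hb : Bornology.IsBounded X)
    (w : Fin n → ℝ) {β t : ℝ} (hβ : 0 < β) (ht : 0 ≤ t) :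
    volume.real (β • X + segment ℝ 0 (t • w)) =
      β ^ n * (volume.real X + t * (β⁻¹ * sweepGain volume X w)) := by
  rw [measureReal_add_segment_smul volume (hX.smul β) (hb.smul₀ β) w ht,
    sweepGain_smul_set volume hX hb w hβ, measureReal_smul_of_nonneg volume hβ.le]
  simp only [Module.finrank_fin_fun]
  ring

theorem tendsto_volume_smul_add_segment_div (hX : Convex ℝ X) (hb : Bornology.IsBounded X)
    (w : Fin n → ℝ) (κ : ℝ) {τ : ℝ} (hτ : 0 ≤ τ) :
    Tendsto (fun α : ℝ => volume.real ((α + κ) • X + segment ℝ 0 ((τ * α) • w)) / α ^ n) atTop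
      (𝓝 (volume.real X + τ * sweepGain volume X w)) := by
  have h1 : Tendsto (fun α : ℝ => (α + κ) / α) atTop (𝓝 1) := by
    have : Tendsto (fun α : ℝ => 1 + κ / α) atTop (𝓝 (1 + 0)) :=
      tendsto_const_nhds.add (tendsto_const_nhds.div_atTop tendsto_id)
    rw [add_zero] at this
    refine this.congr' ?_
    filter_upwards [eventually_gt_atTop 0] with α hα
    field_simp
  have h2 : Tendsto (fun α : ℝ => ((α + κ) / α) ^ n *
      (volume.real X + τ * (((α + κ) / α)⁻¹ * sweepGain volume X w))) atTop
      (𝓝 (1 ^ n * (volume.real X + τ * (1⁻¹ * sweepGain volume X w)))) :=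
    (h1.pow n).mul (tendsto_const_nhds.add
      (tendsto_const_nhds.mul ((h1.inv₀ one_ne_zero).mul tendsto_const_nhds)))
  simp only [one_pow, inv_one, one_mul] at h2
  refine h2.congr' ?_
  filter_upwards [eventually_gt_atTop 0, eventually_gt_atTop (-κ)] with α h0 hκ
  rw [volume_smul_add_segment_smul hX hb w (by linarith) (by positivity), div_pow, inv_div]
  ring

theorem tendsto_ncard_multiples_div (hX : Convex ℝ X) (hb : Bornology.IsBounded X)
    (hint : (interior X).Nonempty) (w : Fin n → ℤ) {τ : ℝ} (hτ : 0 ≤ τ) :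
    Tendsto (fun α : ℝ =>
        ((multiples (latticePoints (α • X)) w ⌊τ * α⌋₊).ncard : ℝ) / α ^ n) atTop
      (𝓝 (volume.real X + τ * sweepGain volume X (toReal w))) := by
  obtain ⟨x₀, hx₀⟩ := hint
  obtain ⟨ρ, hρ, hball⟩ := Metric.nhds_basis_closedBall.mem_iff.1 (mem_interior_iff_mem_nhds.1 hx₀)
  refine tendsto_of_tendsto_of_tendsto_of_le_of_le'
    (tendsto_volume_smul_add_segment_div hX hb (toReal w) (-((‖toReal w‖ + 1) / ρ)) hτ)
    (tendsto_volume_smul_add_segment_div hX hb (toReal w) ((‖toReal w‖ + 1) / ρ) hτ) ?_ ?_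
  · filter_upwards [eventually_ge_atTop 0, eventually_ge_atTop ((‖toReal w‖ + 1) / ρ)] with α h0 hα
    gcongr
    exact le_ncard_multiples_latticePoints hX hb hρ hball w hα (by positivity)
  · filter_upwards [eventually_ge_atTop 0] with α h0
    gcongr
    exact ncard_multiples_latticePoints_le hX hb hρ hball w h0 (by positivity)

theorem tendsto_ncard_latticePoints_div (hX : Convex ℝ X) (hb : Bornology.IsBounded X)
    (hint : (interior X).Nonempty) :
    Tendsto (fun α : ℝ => ((latticePoints (α • X)).ncard : ℝ) / α ^ n) atTop
      (𝓝 (volume.real X)) := by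
  simpa [multiples_zero] using tendsto_ncard_multiples_div hX hb hint 0 le_rfl

/-- The discrete counterpart of the gain: comparing the lattice points of `α • X` with those of its
sweep along `α • w`, whose numbers differ by `⌊α⌋` times the number of exits. -/
theorem tendsto_ncard_exits_mul_div (hX : Convex ℝ X) (hb : Bornology.IsBounded X)
    (hint : (interior X).Nonempty) (w : Fin n → ℤ) :
    Tendsto (fun α : ℝ => ((exits (latticePoints (α • X)) w).ncard : ℝ) * α / α ^ n) atTop
      (𝓝 (sweepGain volume X (toReal w))) := by
  have h1 := (tendsto_ncard_multiples_div hX hb hint w zero_le_one).sub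
    (tendsto_ncard_latticePoints_div hX hb hint)
  have h2 := h1.div (tendsto_nat_floor_div_atTop (R := ℝ)) one_ne_zero
  rw [one_mul, add_sub_cancel_left, div_one] at h2
  refine h2.congr' ?_
  filter_upwards [eventually_ge_atTop 1] with α hα
  have hfl : (0 : ℝ) < ⌊α⌋₊ := by exact_mod_cast Nat.floor_pos.2 hα
  have hα0 : 0 < α := by linarith
  simp only [Pi.div_apply, one_mul]
  rw [ncard_multiples (finite_latticePoints (hb.smul₀ α))
    (fun u hu l hl => add_mem_latticePoints (hX.smul α) u w hu l hl)]
  push_cast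
  field_simp
  ring

end LatticePoints

/-! ### The boundary functional and the edge boundary of a PL graph -/

section Graph

variable {n k : ℕ} {G : SimpleGraph (Fin n → ℤ)} {v : Fin k → Fin n → ℤ}

/-- The `2 k` steps `±v i` along the edges of the graph. -/
def steps (v : Fin k → Fin n → ℤ) : Fin k ⊕ Fin k → Fin n → ℤ := Sum.elim v fun i => -v i

theorem IsPLGraph.ne_zero (hG : IsPLGraph G v) (i : Fin k) : v i ≠ 0 := fun h =>
  hG.ne_neg i i (by rw [h, neg_zero])

theorem IsPLGraph.injective_steps (hG : IsPLGraph G v) : Function.Injective (steps v) :=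
  hG.injective.sumElim (neg_injective.comp hG.injective) hG.ne_neg

theorem IsPLGraph.adj_iff_exists_step (hG : IsPLGraph G v) (u x : Fin n → ℤ) :
    G.Adj u x ↔ ∃ j, x = u + steps v j := by
  rw [hG.adj_iff]
  simp [steps, sub_eq_add_neg, exists_or]

theorem IsPLGraph.nonempty_index (hG : IsPLGraph G v) (hn : 1 ≤ n) : Nonempty (Fin k) := by
  by_contra h
  rw [not_nonempty_iff] at h
  have hs := hG.span_eq_top
  rw [Set.range_eq_empty, Submodule.span_empty] at hs
  have : Nonempty (Fin n) := ⟨⟨0, hn⟩⟩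
  exact bot_ne_top hs

theorem zonotope_eq_sum_steps (v : Fin k → Fin n → ℤ) :
    zonotope v = ∑ j, segment ℝ 0 (toReal (steps v j)) := by
  have hneg : ∀ w : Fin n → ℝ, -segment ℝ 0 w = segment ℝ 0 (-w) := by
    intro w
    rw [← neg_one_smul ℝ w, ← smul_segment_zero]
    simp
  simp only [zonotope, edgeSegment, hneg, Fintype.sum_sum_type, steps, Sum.elim_inl, Sum.elim_inr,
    toReal_neg]
  rw [Finset.sum_add_distrib, add_comm]

variable {X : Set (Fin n → ℝ)}

theorem tendsto_boundaryQuotient_zonotope (v : Fin k → Fin n → ℤ) (hX : Convex ℝ X)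
    (hb : Bornology.IsBounded X) (hint : (interior X).Nonempty) :
    Tendsto (boundaryQuotient (zonotope v) X) (𝓝[>] 0)
      (𝓝 (∑ j, sweepGain volume X (toReal (steps v j)))) := by
  rw [zonotope_eq_sum_steps]
  exact tendsto_measureReal_add_smul_sum_segment_sub_div volume hX hb hint Finset.univ _

theorem interior_smul_nonempty (hint : (interior X).Nonempty) {α : ℝ} (hα : 0 < α) :
    (interior (α • X)).Nonempty := by
  rw [interior_smul₀ hα.ne']
  exact hint.smul_set

theorem boundary_zonotope_smul (v : Fin k → Fin n → ℤ) (hX : Convex ℝ X)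
    (hb : Bornology.IsBounded X) (hint : (interior X).Nonempty) {α : ℝ} (hα : 0 < α) :
    boundary (zonotope v) (α • X) =
      α ^ n * (α⁻¹ * ∑ j, sweepGain volume X (toReal (steps v j))) := by
  rw [boundary, (tendsto_boundaryQuotient_zonotope v (hX.smul α) (hb.smul₀ α)
    (interior_smul_nonempty hint hα)).limUnder_eq]
  simp only [sweepGain_smul_set volume hX hb _ hα, Finset.mul_sum, Module.finrank_fin_fun]

theorem IsPLGraph.sum_sweepGain_pos (hG : IsPLGraph G v) (hn : 1 ≤ n) (hX : Convex ℝ X)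
    (hb : Bornology.IsBounded X) (hint : (interior X).Nonempty) :
    0 < ∑ j, sweepGain volume X (toReal (steps v j)) := by
  have := hG.nonempty_index hn
  refine Finset.sum_pos (fun j _ => sweepGain_pos volume hX hb hint (toReal_ne_zero ?_))
    Finset.univ_nonempty
  rcases j with i | i
  · exact hG.ne_zero i
  · exact neg_ne_zero.2 (hG.ne_zero i)

theorem IsPLGraph.tendsto_ncard_edgeBoundary_mul_div (hG : IsPLGraph G v) (hX : Convex ℝ X)
    (hb : Bornology.IsBounded X) (hint : (interior X).Nonempty) :
    Tendsto (fun α : ℝ => ((edgeBoundary G (latticePoints (α • X))).ncard : ℝ) * α / α ^ n) atTop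
      (𝓝 (∑ j, sweepGain volume X (toReal (steps v j)))) := by
  refine (tendsto_finsetSum Finset.univ fun j _ =>
    tendsto_ncard_exits_mul_div hX hb hint (steps v j)).congr fun α => ?_
  rw [ncard_edgeBoundary hG.injective_steps hG.adj_iff_exists_step
    (finite_latticePoints (hb.smul₀ α)), Nat.cast_sum, Finset.sum_mul, Finset.sum_div]

end Graph

end PL

theorem lemma1 {n k : ℕ} (hn : 1 ≤ n) (G : SimpleGraph (Fin n → ℤ)) (v : Fin k → Fin n → ℤ)
    (hG : PL.IsPLGraph G v) (X : Set (Fin n → ℝ)) (hconv : Convex ℝ X)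
    (hbdd : Bornology.IsBounded X) (hint : (interior X).Nonempty) :
    (∀ α : ℝ, 0 < α → Tendsto (PL.boundaryQuotient (PL.zonotope v) (α • X)) (𝓝[>] 0)
      (𝓝 (PL.boundary (PL.zonotope v) (α • X)))) ∧
    Tendsto (fun α : ℝ => volume.real (α • X) / ((PL.latticePoints (α • X)).ncard : ℝ))
      atTop (𝓝 1) ∧
    Tendsto (fun α : ℝ => PL.boundary (PL.zonotope v) (α • X) /
      ((PL.edgeBoundary G (PL.latticePoints (α • X))).ncard : ℝ)) atTop (𝓝 1) := by
  refine ⟨fun α hα => tendsto_nhds_limUnder ⟨_, PL.tendsto_boundaryQuotient_zonotope v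
    (hconv.smul α) (hbdd.smul₀ α) (PL.interior_smul_nonempty hint hα)⟩, ?_, ?_⟩
  · have hV : volume.real X ≠ 0 := (ENNReal.toReal_pos
      (Measure.measure_pos_of_nonempty_interior volume hint).ne' hbdd.measure_lt_top.ne).ne'
    have h := (tendsto_const_nhds (x := volume.real X)).div
      (PL.tendsto_ncard_latticePoints_div hconv hbdd hint) hV
    rw [div_self hV] at h
    refine h.congr' ?_
    filter_upwards [eventually_gt_atTop 0] with α hα
    rw [Pi.div_apply, PL.measureReal_smul_of_nonneg volume hα.le, Module.finrank_fin_fun,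
      div_div_eq_mul_div, mul_comm]
  · have hC := (hG.sum_sweepGain_pos hn hconv hbdd hint).ne'
    have h := (tendsto_const_nhds
      (x := ∑ j, PL.sweepGain volume X (PL.toReal (PL.steps v j)))).div
      (hG.tendsto_ncard_edgeBoundary_mul_div hconv hbdd hint) hC
    rw [div_self hC] at h
    refine h.congr' ?_
    filter_upwards [eventually_gt_atTop 0] with α hα
    rw [Pi.div_apply, PL.boundary_zonotope_smul v hconv hbdd hint hα]
    field_simp
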